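/- Let $L$ be a number field with ring of integers $\mathcal O_L$, and let $\lambda=x/y\in L$ with non-zero $x,y\in\mathcal O_L$ such that $x\mathcal O_L+y\mathcal O_L=\mathcal O_L$. Assume that $\lambda$ has no conjugate of modulus $1$, i.e. $|\sigma(\lambda)|\neq 1$ for every embedding $\sigma:L\to\mathbb C$. Let $B=\mathcal O_L[\lambda^{\pm1}]\subseteq L$ and $G=\langle t\rangle\ltimes B$, where $\langle t\rangle$ is infinite cyclic and $t$ acts on the additive group $B$ by multiplication by $\lambda$. For $\gamma/\alpha\in\mathbb Q$ with $\gamma,\alpha\in\mathbb Z$, $\alpha\ne0$, put $\mu(\gamma/\alpha)=|\gamma\alpha|/\gcd(\gamma,\alpha)^2$; for a basis $v_1,\dots,v_n$ of $L$ over $\mathbb Q$ and $b=\sum_i\beta_iv_i\in L$ with $\beta_i\in\mathbb Q$, put $\mu_E(b)=\sum_i\mu(\beta_i)$. Then $G$ is finitely generated. Moreover, for every finite generating set $S$ of $G$, with word length $\|\cdot\|_G$ with respect to $S$, and for every basis of $L$ over $\mathbb Q$, with the corresponding $\mu_E$, one has $$\|b\|_G\preccurlyeq\ln(\mu_E(b)+1)\qquad\text{for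 } b\in B,$$ that is, there are constants $C\ge 0$ and $M\ge 1$, independent of $b$, such that $\|b\|_G\le M\ln(\mu_E(b)+1)+C$ for all $b\in B$. -/

import Mathlib

open scoped NumberField

/-- `f ≼ g`: there are constants `C ≥ 0` and `M ≥ 1` with `f x ≤ M * g x + C` for all `x`. -/
def QuasiLE {X : Type*} (f g : X → ℝ) : Prop :=
  ∃ C : ℝ, 0 ≤ C ∧ ∃ M : ℝ, 1 ≤ M ∧ ∀ x, f x ≤ M * g x + C

/-- The geodesic word length of `g` with respect to `S`: the least length of a word in the letters
`s`, `s⁻¹` (`s ∈ S`) that represents `g`. (Only used when `S` generates the group.) -/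
noncomputable def wordLength {G : Type*} [Group G] (S : Set G) (g : G) : ℕ :=
  sInf {n : ℕ | ∃ w : List G, w.length = n ∧ (∀ a ∈ w, a ∈ S ∨ a⁻¹ ∈ S) ∧ w.prod = g}

/-- `μ(γ/α) = |γ α| / gcd(γ, α)²`, written through the reduced fraction of `q`. -/
def ratMu (q : ℚ) : ℕ := q.num.natAbs * q.den

theorem ratMu_div (γ α : ℤ) (hα : α ≠ 0) :
    (ratMu ((γ : ℚ) / α) : ℚ) = |(γ : ℚ) * α| / (Int.gcd γ α : ℚ) ^ 2 := by
  obtain ⟨c, h1, h2⟩ := Rat.num_den_mk (q := (γ : ℚ) / α) (n := γ) (d := α) hα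
    (by rw [Rat.divInt_eq_div])
  set q : ℚ := (γ : ℚ) / α
  have hc : c ≠ 0 := by
    rintro rfl
    simp at h2
    exact hα h2
  have hg : Int.gcd γ α = c.natAbs := by
    rw [h1, h2, Int.gcd_mul_left]
    have : Int.gcd q.num (q.den : ℤ) = 1 := q.reduced
    rw [this, mul_one]
  have hcq : ((c.natAbs : ℕ) : ℚ) = |(c : ℚ)| := by
    rw [Nat.cast_natAbs, Int.cast_abs]
  have hnq : ((q.num.natAbs : ℕ) : ℚ) = |(q.num : ℚ)| := by
    rw [Nat.cast_natAbs, Int.cast_abs]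
  have hcq0 : (c : ℚ) ≠ 0 := by exact_mod_cast hc
  have e1 : (γ : ℚ) = c * q.num := by exact_mod_cast h1
  have e2 : (α : ℚ) = c * q.den := by exact_mod_cast h2
  rw [hg, hcq, sq_abs, e1, e2, ratMu, Nat.cast_mul, hnq]
  have : (c : ℚ) * q.num * (c * q.den) = c ^ 2 * (q.num * q.den) := by ring
  rw [this, abs_mul, abs_mul, abs_of_nonneg (sq_nonneg (c : ℚ)), Nat.abs_cast]
  field_simp

/-- `μ_E` with respect to a basis `v` of a finite-dimensional rational vector space:
the sum of the `μ`-values of the coordinates. -/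
noncomputable def muE {ι V : Type*} [Fintype ι] [AddCommGroup V] [Module ℚ V]
    (v : Module.Basis ι ℚ V) (b : V) : ℕ :=
  ∑ i, ratMu (v.repr b i)

section

variable {L : Type*} [Field L]

/-- The ring `𝓞_L[λ^{±1}]` as a subring of `L`. -/
noncomputable abbrev laurentRing (lam : Lˣ) : Subalgebra (𝓞 L) L :=
  Algebra.adjoin (𝓞 L) {(lam : L), ((lam⁻¹ : Lˣ) : L)}

/-- `λ` as a unit of `𝓞_L[λ^{±1}]`. -/
noncomputable def laurentUnit (lam : Lˣ) : (laurentRing lam)ˣ where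
  val := ⟨(lam : L), Algebra.subset_adjoin (by simp)⟩
  inv := ⟨((lam⁻¹ : Lˣ) : L), Algebra.subset_adjoin (by simp)⟩
  val_inv := Subtype.ext (by simp)
  inv_val := Subtype.ext (by simp)

/-- The action of `⟨t⟩ ≅ ℤ` on the additive group `B = 𝓞_L[λ^{±1}]` (written multiplicatively)
in which `t` acts by multiplication by `λ`. -/
noncomputable def laurentAction (lam : Lˣ) :
    Multiplicative ℤ →* MulAut (Multiplicative (laurentRing lam)) :=
  zpowersHom _ ((MulAutMultiplicative (laurentRing lam)).symm
    (AddAut.mulLeft (laurentUnit lam)))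

theorem laurentAction_apply (lam : Lˣ) (k : ℤ) (b : laurentRing lam) :
    ((laurentAction lam (Multiplicative.ofAdd k) (Multiplicative.ofAdd b)).toAdd : L)
      = ((lam ^ k : Lˣ) : L) * b := by
  have hu : ∀ k : ℤ, (((laurentUnit lam ^ k : (laurentRing lam)ˣ) : laurentRing lam) : L)
      = ((lam ^ k : Lˣ) : L) := by
    intro k
    have h : Units.map ((laurentRing lam).val : laurentRing lam →* L) (laurentUnit lam) = lam :=
      Units.ext rfl
    have := congrArg (fun z : Lˣ => ((z ^ k : Lˣ) : L)) h
    rw [← this]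
    simp only [← map_zpow]
    rfl
  rw [← hu]
  have : laurentAction lam (Multiplicative.ofAdd k) =
      (MulAutMultiplicative (laurentRing lam)).symm
        (AddAut.mulLeft (laurentUnit lam ^ k)) := by
    simp [laurentAction, zpowersHom_apply]
  rw [this]
  rfl

/-- `G = ⟨t⟩ ⋉ 𝓞_L[λ^{±1}]`. -/
noncomputable abbrev LaurentGroup (lam : Lˣ) : Type _ :=
  Multiplicative (laurentRing lam) ⋊[laurentAction lam] Multiplicative ℤ

/-- The element of `G` given by `b ∈ B`. -/
noncomputable def LaurentGroup.ofBase (lam : Lˣ) (b : laurentRing lam) : LaurentGroup lam :=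
  SemidirectProduct.inl (Multiplicative.ofAdd b)

end

/-! Conjugation by `t ^ k` multiplies an element of `B` by `λ ^ k` and costs only `O(|k|)` letters.
Two facts turn this into a logarithmic bound.

Distortion of integers. All conjugates of a suitable power `θ = λ ^ m` are very small or very large,
so the minimal polynomial of `θ` is, up to scaling, close to a monomial: one coefficient `q`
outweighs twice the sum of the others. The relation `q θ ^ j = -R(θ)` then serves as a carry rule
for expansions in base `q`. Each carry halves the large part of the coefficients, so for `|a| ≤ 2 ^
N` the element `θ ^ (j N) a` is a polynomial in `θ` of degree `O(N)` with bounded digits. Horner's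
scheme spells it with `O(N)` letters (`exists_wordLength_ofBase_zsmul_le`).

Splitting. If `μ_E(b) < 2 ^ N`, the coordinates of `b` and a natural denominator of `b` are at most
exponential in `N`. Counting prime ideals shows that `(x y) ^ k b` is integral for some `k = O(N)`
(`exists_integral_pow_mul`). Coprimality of `x` and `y` then gives `b = λ ^ k u + λ ^ (-k) w` with
`u`, `w` integral and of exponentially bounded coordinates (`exists_logarithmic_split`). Expanding
`u` and `w` in an integral basis reduces the bound to the first fact; the splitting also yields
finite generation. -/

/-! ### Word length in a group. -/

section WordLength

variable {G : Type*} [Group G] {S : Set G}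

theorem wordLength_prod_le {w : List G} (hw : ∀ a ∈ w, a ∈ S ∨ a⁻¹ ∈ S) :
    wordLength S w.prod ≤ w.length :=
  Nat.sInf_le ⟨w, rfl, hw, rfl⟩

theorem exists_word (hS : Subgroup.closure S = ⊤) (g : G) :
    ∃ w : List G, w.length = wordLength S g ∧ (∀ a ∈ w, a ∈ S ∨ a⁻¹ ∈ S) ∧ w.prod = g := by
  have hg : g ∈ (Subgroup.closure S).toSubmonoid := hS ▸ Subgroup.mem_top g
  rw [Subgroup.closure_toSubmonoid] at hg
  obtain ⟨w, hw, rfl⟩ := Submonoid.exists_list_of_mem_closure hg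
  exact Nat.sInf_mem (s := {n : ℕ | ∃ v : List G, v.length = n ∧
    (∀ a ∈ v, a ∈ S ∨ a⁻¹ ∈ S) ∧ v.prod = w.prod}) ⟨_, w, rfl, hw, rfl⟩

theorem wordLength_one : wordLength S (1 : G) = 0 :=
  Nat.le_zero.1 (wordLength_prod_le (w := []) (by simp))

theorem wordLength_mul_le (hS : Subgroup.closure S = ⊤) (g h : G) :
    wordLength S (g * h) ≤ wordLength S g + wordLength S h := by
  obtain ⟨v, hv, hv', rfl⟩ := exists_word hS g
  obtain ⟨w, hw, hw', rfl⟩ := exists_word hS h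
  rw [← hv, ← hw, ← List.prod_append, ← List.length_append]
  refine wordLength_prod_le fun a ha => ?_
  rcases List.mem_append.1 ha with ha | ha
  exacts [hv' a ha, hw' a ha]

theorem wordLength_inv_le (hS : Subgroup.closure S = ⊤) (g : G) :
    wordLength S g⁻¹ ≤ wordLength S g := by
  obtain ⟨v, hv, hv', rfl⟩ := exists_word hS g
  rw [← hv, List.prod_inv_reverse]
  refine (wordLength_prod_le fun a ha => ?_).trans (by simp)
  simp only [List.mem_reverse, List.mem_map] at ha
  obtain ⟨c, hc, rfl⟩ := ha
  simpa [or_comm] using hv' c hc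

theorem wordLength_pow_le (hS : Subgroup.closure S = ⊤) (g : G) (n : ℕ) :
    wordLength S (g ^ n) ≤ n * wordLength S g := by
  induction n with
  | zero => simp [wordLength_one]
  | succ n ih =>
    rw [pow_succ, add_mul, one_mul]
    exact (wordLength_mul_le hS _ _).trans (by gcongr)

theorem wordLength_zpow_le (hS : Subgroup.closure S = ⊤) (g : G) (n : ℤ) :
    wordLength S (g ^ n) ≤ n.natAbs * wordLength S g := by
  obtain ⟨k, rfl | rfl⟩ := n.eq_nat_or_neg
  · simpa using wordLength_pow_le hS g k
  · simpa using (wordLength_inv_le hS _).trans (wordLength_pow_le hS g k)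

end WordLength

/-! ### The base `B` inside `G`, and conjugation by `t`. -/

namespace LaurentGroup

variable {L : Type*} [Field L] {lam : Lˣ}

theorem ofBase_add (b c : laurentRing lam) : ofBase lam (b + c) = ofBase lam b * ofBase lam c := by
  simp [ofBase, ofAdd_add]

theorem ofBase_zsmul (n : ℤ) (b : laurentRing lam) : ofBase lam (n • b) = ofBase lam b ^ n := by
  rw [ofBase, ofAdd_zsmul, map_zpow, ofBase]

/-- The generator `t` of the infinite cyclic factor. -/
noncomputable def stable (lam : Lˣ) : LaurentGroup lam :=
  SemidirectProduct.inr (Multiplicative.ofAdd 1)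

theorem stable_zpow (k : ℤ) :
    stable lam ^ k = SemidirectProduct.inr (Multiplicative.ofAdd k) := by
  rw [stable, ← map_zpow, ← ofAdd_zsmul]
  simp

theorem ofBase_eq_conj {b c : laurentRing lam} {k : ℤ}
    (h : (b : L) = ((lam ^ k : Lˣ) : L) * c) :
    ofBase lam b = stable lam ^ k * ofBase lam c * (stable lam ^ k)⁻¹ := by
  rw [stable_zpow, ofBase, ofBase, ← map_inv, ← SemidirectProduct.inl_aut]
  congr 1
  apply Multiplicative.toAdd.injective
  apply Subtype.ext
  rw [laurentAction_apply, toAdd_ofAdd, h]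

theorem eq_ofBase_mul_zpow (g : LaurentGroup lam) :
    ∃ (b : laurentRing lam) (k : ℤ), g = ofBase lam b * stable lam ^ k := by
  refine ⟨g.left.toAdd, g.right.toAdd, ?_⟩
  rw [stable_zpow]
  exact (SemidirectProduct.inl_left_mul_inr_right g).symm

variable {S : Set (LaurentGroup lam)}

theorem wordLength_ofBase_add_le (hS : Subgroup.closure S = ⊤) (b c : laurentRing lam) :
    wordLength S (ofBase lam (b + c)) ≤
      wordLength S (ofBase lam b) + wordLength S (ofBase lam c) := by
  rw [ofBase_add]
  exact wordLength_mul_le hS _ _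

theorem wordLength_ofBase_sum_le (hS : Subgroup.closure S = ⊤) {κ : Type*} (s : Finset κ)
    (f : κ → laurentRing lam) :
    wordLength S (ofBase lam (∑ i ∈ s, f i)) ≤ ∑ i ∈ s, wordLength S (ofBase lam (f i)) := by
  classical
  induction s using Finset.induction_on with
  | empty => simp [ofBase, wordLength_one]
  | insert a s ha ih =>
    rw [Finset.sum_insert ha, Finset.sum_insert ha]
    exact (wordLength_ofBase_add_le hS _ _).trans (by gcongr)

theorem wordLength_ofBase_zsmul_le (hS : Subgroup.closure S = ⊤) (n : ℤ) (b : laurentRing lam) :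
    wordLength S (ofBase lam (n • b)) ≤ n.natAbs * wordLength S (ofBase lam b) := by
  rw [ofBase_zsmul]
  exact wordLength_zpow_le hS _ _

theorem wordLength_ofBase_le_of_eq (hS : Subgroup.closure S = ⊤) {b c : laurentRing lam} {k : ℤ}
    (h : (b : L) = ((lam ^ k : Lˣ) : L) * c) :
    wordLength S (ofBase lam b) ≤
      wordLength S (ofBase lam c) + 2 * k.natAbs * wordLength S (stable lam) := by
  rw [ofBase_eq_conj h]
  have h1 := wordLength_mul_le hS (stable lam ^ k * ofBase lam c) (stable lam ^ k)⁻¹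
  have h2 := wordLength_mul_le hS (stable lam ^ k) (ofBase lam c)
  have h3 := wordLength_inv_le hS (stable lam ^ k)
  have h4 := wordLength_zpow_le hS (stable lam) k
  linarith

end LaurentGroup

/-! ### A dominant coefficient from conjugates off the unit circle. -/

section Dominant

open Polynomial

/-- A factor `X - a` is coefficientwise `ε`-close to `X` if `a` is small, and after scaling by
`-a⁻¹` to `1` if `a` is large. Hence the scaled product is close to a monomial; one more factor
turns an error `δ` into at most `(1 + δ)(1 + ε) - 1`. -/
theorem exists_dominant_coeff_prod_X_sub_C {ε : ℝ} (hε : 0 ≤ ε) (s : Multiset ℂ)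
    (hs : ∀ a ∈ s, ‖a‖ ≤ ε ∨ (a ≠ 0 ∧ ‖a⁻¹‖ ≤ ε)) :
    ∃ c : ℂ, ∃ j : ℕ, ∀ i, ‖(C c * (s.map fun a => X - C a).prod - X ^ j).coeff i‖ ≤
      (1 + ε) ^ s.card - 1 := by
  induction s using Multiset.induction_on with
  | empty => exact ⟨1, 0, by simp⟩
  | cons a s ih =>
    obtain ⟨c, j, h⟩ := ih fun b hb => hs b (Multiset.mem_cons_of_mem hb)
    set P := (s.map fun a => X - C a).prod
    set g := C c * P - X ^ j with hg
    set δ := (1 + ε) ^ s.card - 1 with hδ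
    have hδ0 : 0 ≤ δ := (norm_nonneg _).trans (h 0)
    have hX : ∀ (k i : ℕ), ‖((X : ℂ[X]) ^ k).coeff i‖ ≤ 1 := by
      intro k i
      rw [coeff_X_pow]
      split_ifs <;> simp
    have hXg : ∀ i, ‖(X * g).coeff i‖ ≤ δ := by
      intro i
      rcases i with _ | i
      · simpa using hδ0
      · rw [coeff_X_mul]; exact h i
    rw [Multiset.map_cons, Multiset.prod_cons, Multiset.card_cons]
    have hb : δ + ε * 1 + ε * δ = (1 + ε) ^ (s.card + 1) - 1 := by
      rw [pow_succ, hδ]; ring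
    rw [← hb]
    rcases hs a (Multiset.mem_cons_self a s) with ha | ⟨ha0, ha⟩
    · refine ⟨c, j + 1, fun i => ?_⟩
      have e : C c * ((X - C a) * P) - X ^ (j + 1) = X * g - C a * X ^ j - C a * g := by
        rw [hg]; ring
      rw [e, coeff_sub, coeff_sub, coeff_C_mul, coeff_C_mul]
      refine (norm_sub_le _ _).trans (add_le_add ((norm_sub_le _ _).trans (add_le_add ?_ ?_)) ?_)
      · exact hXg i
      · rw [norm_mul]
        exact mul_le_mul ha (hX j i) (norm_nonneg _) hε
      · rw [norm_mul]
        exact mul_le_mul ha (h i) (norm_nonneg _) hε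
    · refine ⟨-a⁻¹ * c, j, fun i => ?_⟩
      have e : C (-a⁻¹ * c) * ((X - C a) * P) - X ^ j =
          g - C a⁻¹ * X ^ (j + 1) - C a⁻¹ * (X * g) := by
        have h1 : (C a⁻¹ : ℂ[X]) * C a = 1 := by rw [← C_mul, inv_mul_cancel₀ ha0, C_1]
        rw [hg, C_mul, C_neg]
        linear_combination (C c * P) * h1
      rw [e, coeff_sub, coeff_sub, coeff_C_mul, coeff_C_mul]
      refine (norm_sub_le _ _).trans (add_le_add ((norm_sub_le _ _).trans (add_le_add ?_ ?_)) ?_)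
      · exact h i
      · rw [norm_mul]
        exact mul_le_mul ha (hX _ i) (norm_nonneg _) hε
      · rw [norm_mul]
        exact mul_le_mul ha (hXg i) (norm_nonneg _) hε

theorem exists_pos_one_add_pow_sub_one_le (d : ℕ) {δ : ℝ} (hδ : 0 < δ) :
    ∃ ε : ℝ, 0 < ε ∧ ∀ k ≤ d, (1 + ε) ^ k - 1 ≤ δ := by
  have hc : Filter.Tendsto (fun ε : ℝ => (1 + ε) ^ d - 1) (nhdsWithin 0 (Set.Ioi 0)) (nhds 0) := by
    have : Continuous fun ε : ℝ => (1 + ε) ^ d - 1 := by fun_prop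
    simpa using (this.tendsto 0).mono_left nhdsWithin_le_nhds
  obtain ⟨ε, h1, h2⟩ := ((hc.eventually_le_const hδ).and self_mem_nhdsWithin).exists
  refine ⟨ε, h2, fun k hk => le_trans ?_ h1⟩
  have h3 : 0 < ε := h2
  gcongr
  linarith

variable {L : Type*} [Field L] [NumberField L]

theorem exists_pow_conjugates_small_or_large {a : L} (ha : a ≠ 0)
    (hconj : ∀ σ : L →+* ℂ, ‖σ a‖ ≠ 1) {ε : ℝ} (hε : 0 < ε) :
    ∃ m : ℕ, ∀ σ : L →+* ℂ, ‖σ (a ^ m)‖ ≤ ε ∨ (σ (a ^ m) ≠ 0 ∧ ‖(σ (a ^ m))⁻¹‖ ≤ ε) := by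
  have : ∀ᶠ m : ℕ in Filter.atTop, ∀ σ : L →+* ℂ,
      ‖σ (a ^ m)‖ ≤ ε ∨ (σ (a ^ m) ≠ 0 ∧ ‖(σ (a ^ m))⁻¹‖ ≤ ε) := by
    refine Filter.eventually_all.2 fun σ => ?_
    rcases lt_or_gt_of_ne (hconj σ) with h | h
    · filter_upwards [(tendsto_pow_atTop_nhds_zero_of_lt_one (norm_nonneg _) h).eventually_le_const
        hε] with m hm
      exact Or.inl (by simpa using hm)
    · have h' : ‖σ a‖⁻¹ < 1 := inv_lt_one_of_one_lt₀ h
      filter_upwards [(tendsto_pow_atTop_nhds_zero_of_lt_one (by positivity) h').eventually_le_const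
        hε] with m hm
      exact Or.inr ⟨map_ne_zero σ |>.2 (pow_ne_zero m ha), by simpa using hm⟩
  exact this.exists

theorem exists_dominant_minpoly_pow {a : L} (ha : a ≠ 0)
    (hconj : ∀ σ : L →+* ℂ, ‖σ a‖ ≠ 1) :
    ∃ m j : ℕ, (minpoly ℚ (a ^ m)).coeff j ≠ 0 ∧
      ∀ s : Finset ℕ, j ∉ s → s ⊆ Finset.range ((minpoly ℚ (a ^ m)).natDegree + 1) →
        2 * ∑ i ∈ s, |(minpoly ℚ (a ^ m)).coeff i| ≤ |(minpoly ℚ (a ^ m)).coeff j| := by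
  set d := Module.finrank ℚ L
  -- At most `d + 1` other coefficients have scaled size at most `δ`, while the main one has at
  -- least `1 - δ`. The choice of `δ` makes `2 (d + 1) δ = 1 - δ`.
  obtain ⟨ε, hε, hd⟩ := exists_pos_one_add_pow_sub_one_le d (δ := 1 / (2 * d + 3)) (by positivity)
  obtain ⟨m, hm⟩ := exists_pow_conjugates_small_or_large ha hconj hε
  set f := minpoly ℚ (a ^ m) with hf
  have hint : IsIntegral ℚ (a ^ m) := Algebra.IsIntegral.isIntegral _
  set F := f.map (algebraMap ℚ ℂ) with hF
  have hFs : F.Splits := IsAlgClosed.splits F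
  have hFm : F.Monic := (minpoly.monic hint).map _
  have hprod := hFs.eq_prod_roots_of_monic hFm
  have hroot : ∀ z ∈ F.roots, ∃ σ : L →+* ℂ, σ (a ^ m) = z := by
    intro z hz
    have : z ∈ f.rootSet ℂ := by
      rw [mem_rootSet_of_ne (minpoly.ne_zero hint), aeval_def, ← eval_map]
      exact (mem_roots'.1 hz).2
    rw [← NumberField.Embeddings.range_eval_eq_rootSet_minpoly L ℂ (a ^ m)] at this
    exact this
  have hcard : F.roots.card ≤ d := by
    refine (card_roots' F).trans ?_
    rw [hF, natDegree_map]
    exact minpoly.natDegree_le _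
  have hfd : f.natDegree ≤ d := minpoly.natDegree_le _
  obtain ⟨c, j, h⟩ := exists_dominant_coeff_prod_X_sub_C hε.le F.roots (by
    intro z hz
    obtain ⟨σ, rfl⟩ := hroot z hz
    exact hm σ)
  rw [← hprod] at h
  have hco : ∀ i, F.coeff i = ((f.coeff i : ℚ) : ℂ) := by
    intro i; rw [hF, coeff_map]; rfl
  have hnorm : ∀ i, ‖F.coeff i‖ = ((|f.coeff i| : ℚ) : ℝ) := by
    intro i
    rw [hco, ← Complex.ofReal_ratCast, Complex.norm_real, Real.norm_eq_abs, Rat.cast_abs]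
  set δ : ℝ := 1 / (2 * d + 3) with hδ
  have hδ1 : δ * (2 * d + 3) = 1 := by rw [hδ]; field_simp
  have hδ0 : 0 < δ := by positivity
  have h' : ∀ i, ‖c * F.coeff i - if i = j then 1 else 0‖ ≤ δ := by
    intro i
    have := (h i).trans (hd _ hcard)
    rwa [coeff_sub, coeff_C_mul, coeff_X_pow] at this
  have hj : 1 - δ ≤ ‖c‖ * ‖F.coeff j‖ := by
    have h1 := h' j
    rw [if_pos rfl] at h1
    have h2 := norm_sub_norm_le (1 : ℂ) (c * F.coeff j)
    rw [norm_sub_rev, norm_one, norm_mul] at h2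
    linarith
  have hi : ∀ i, i ≠ j → ‖c‖ * ‖F.coeff i‖ ≤ δ := by
    intro i hij
    have h1 := h' i
    rwa [if_neg hij, sub_zero, norm_mul] at h1
  have hδ2 : δ < 1 := by nlinarith [(Nat.cast_nonneg d : (0 : ℝ) ≤ d)]
  have hc : 0 < ‖c‖ := by
    rcases (norm_nonneg c).eq_or_lt with h0 | h0
    · rw [← h0] at hj; linarith
    · exact h0
  refine ⟨m, j, ?_, fun s hjs hs => ?_⟩
  · intro h0
    have : F.coeff j = 0 := by rw [hco, h0]; simp
    rw [this] at hj
    simp at hj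
    linarith
  · have hs1 : (s.card : ℝ) ≤ d + 1 := by
      have := Finset.card_le_card hs
      rw [Finset.card_range] at this
      rw [← hf] at this
      exact_mod_cast this.trans (Nat.succ_le_succ hfd)
    have hsum : ‖c‖ * ∑ i ∈ s, ‖F.coeff i‖ ≤ s.card * δ := by
      rw [Finset.mul_sum, ← nsmul_eq_mul]
      exact Finset.sum_le_card_nsmul _ _ _ fun i his => hi i fun hij => hjs (hij ▸ his)
    have key : 2 * ∑ i ∈ s, ‖F.coeff i‖ ≤ ‖F.coeff j‖ := by
      refine le_of_mul_le_mul_left ?_ hc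
      have := mul_le_mul_of_nonneg_right hs1 hδ0.le
      linarith
    simp only [hnorm] at key
    exact_mod_cast key

/-- A relation `q θ ^ j = - R(θ)` for a power `θ` of `a` in which `q` dominates `R`. -/
theorem exists_dominant_relation {a : L} (ha : a ≠ 0)
    (hconj : ∀ σ : L →+* ℂ, ‖σ a‖ ≠ 1) :
    ∃ (m j : ℕ) (q : ℤ) (R : ℤ[X]), q ≠ 0 ∧
      2 * ∑ i ∈ Finset.range (R.natDegree + 1), |R.coeff i| ≤ |q| ∧
      aeval (a ^ m) (C q * X ^ j + R) = 0 := by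
  obtain ⟨m, j, hj, hdom⟩ := exists_dominant_minpoly_pow ha hconj
  set f := minpoly ℚ (a ^ m) with hf
  -- Clearing denominators scales all coefficients by the same `b`, which preserves dominance.
  obtain ⟨b, hb, hbf⟩ := IsLocalization.integerNormalization_spec (nonZeroDivisors ℤ) f
  set Q := IsLocalization.integerNormalization (nonZeroDivisors ℤ) f
  have hb0 : b ≠ 0 := nonZeroDivisors.ne_zero hb
  have hco : ∀ i, ((Q.coeff i : ℤ) : ℚ) = b * f.coeff i := by
    intro i
    have := congrArg (fun p => p.coeff i) hbf
    simpa [coeff_map] using this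
  refine ⟨m, j, Q.coeff j, Q.erase j, ?_, ?_, ?_⟩
  · intro h0
    have := hco j
    rw [h0] at this
    simp [hb0, hj] at this
  · have hdeg : Q.natDegree ≤ f.natDegree := by
      refine natDegree_le_iff_coeff_eq_zero.2 fun i hi => ?_
      have := hco i
      rw [coeff_eq_zero_of_natDegree_lt hi, mul_zero] at this
      exact_mod_cast this
    have h1 : ∑ i ∈ Finset.range ((Q.erase j).natDegree + 1), |(Q.erase j).coeff i| ≤
        ∑ i ∈ (Finset.range (f.natDegree + 1)).erase j, |Q.coeff i| := by
      have e : ∀ i, |(Q.erase j).coeff i| = if i = j then 0 else |Q.coeff i| := by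
        intro i; rw [coeff_erase]; split_ifs <;> simp
      simp only [e]
      rw [← Finset.sum_filter_ne_zero, Finset.sum_ite, Finset.sum_const_zero, zero_add]
      refine Finset.sum_le_sum_of_subset_of_nonneg ?_ fun _ _ _ => abs_nonneg _
      intro i hi
      simp only [Finset.mem_filter, ne_eq, ite_eq_left_iff, Finset.mem_erase, Finset.mem_range,
        abs_eq_zero, Classical.not_imp] at hi ⊢
      refine ⟨hi.2, Nat.lt_succ_of_le (le_trans ?_ hdeg)⟩
      exact le_natDegree_of_ne_zero hi.1.2.2
    have h2 := hdom ((Finset.range (f.natDegree + 1)).erase j) (by simp) (Finset.erase_subset _ _)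
    have h3 : 2 * ∑ i ∈ (Finset.range (f.natDegree + 1)).erase j, |Q.coeff i| ≤ |Q.coeff j| := by
      have : (2 * ∑ i ∈ (Finset.range (f.natDegree + 1)).erase j, |(Q.coeff i : ℚ)|) ≤
          |(Q.coeff j : ℚ)| := by
        simp only [hco, abs_mul]
        rw [← Finset.mul_sum]
        have := mul_le_mul_of_nonneg_left h2 (abs_nonneg (b : ℚ))
        linarith
      exact_mod_cast this
    linarith
  · rw [C_mul_X_pow_eq_monomial, monomial_add_erase, ← aeval_map_algebraMap ℚ]
    rw [hbf, map_zsmul, minpoly.aeval, smul_zero]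

end Dominant

/-! ### Expansions with carries. -/

section Digits

open Polynomial

theorem abs_coeff_mul_le (R s : ℤ[X]) {A : ℝ} (hs : ∀ i, |(s.coeff i : ℝ)| ≤ A) (n : ℕ) :
    |((R * s).coeff n : ℝ)| ≤ (∑ i ∈ Finset.range (R.natDegree + 1), |(R.coeff i : ℝ)|) * A := by
  have hA : 0 ≤ A := (abs_nonneg _).trans (hs 0)
  conv_lhs => rw [R.as_sum_range_C_mul_X_pow]
  rw [Finset.sum_mul, finsetSum_coeff, Int.cast_sum, Finset.sum_mul]
  refine (Finset.abs_sum_le_sum_abs _ _).trans (Finset.sum_le_sum fun i _ => ?_)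
  rw [mul_assoc, coeff_C_mul, coeff_X_pow_mul', Int.cast_mul, abs_mul]
  refine mul_le_mul_of_nonneg_left ?_ (abs_nonneg _)
  split_ifs
  · exact hs _
  · simpa using hA

/-- Truncated division keeps `|s| ≤ |p| / |q|` coefficientwise for either sign, and sends `0` to
`0`, so degrees do not grow. -/
theorem exists_coeff_tdiv_tmod (p : ℤ[X]) (q : ℤ) :
    ∃ r s : ℤ[X], p = r + C q * s ∧ (∀ i, r.coeff i = (p.coeff i).tmod q) ∧
      (∀ i, s.coeff i = (p.coeff i).tdiv q) := by
  set s : ℤ[X] := ∑ i ∈ Finset.range (p.natDegree + 1), monomial i ((p.coeff i).tdiv q) with hs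
  have hsc : ∀ i, s.coeff i = (p.coeff i).tdiv q := by
    intro i
    rw [hs, finsetSum_coeff]
    simp only [coeff_monomial, Finset.sum_ite_eq', Finset.mem_range]
    split_ifs with h
    · rfl
    · rw [coeff_eq_zero_of_natDegree_lt (by omega), Int.zero_tdiv]
  refine ⟨p - C q * s, s, by ring, fun i => ?_, hsc⟩
  rw [coeff_sub, coeff_C_mul, hsc]
  have := Int.tmod_add_mul_tdiv (p.coeff i) q
  linarith

/-- With `p = r + q s`, the term `q X ^ j s` is traded for `-R s`. The remainders contribute at most
`|q|`; since the coefficients of `R` sum to at most `|q| / 2` in absolute value and those of `s` are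
at most `A / |q|`, the carries contribute at most `A / 2`. The factor `X ^ j` makes room for the
trade. -/
theorem carry_step {q : ℤ} {R : ℤ[X]} {j D : ℕ} (hq : q ≠ 0)
    (hdom : 2 * ∑ i ∈ Finset.range (R.natDegree + 1), |R.coeff i| ≤ |q|)
    (hj : j ≤ D) (hR : R.natDegree ≤ D) (p : ℤ[X]) {A : ℝ} (hp : ∀ i, |(p.coeff i : ℝ)| ≤ A) :
    ∃ p' s : ℤ[X], X ^ j * p = p' + (C q * X ^ j + R) * s ∧ p'.natDegree ≤ p.natDegree + D ∧
      ∀ i, |(p'.coeff i : ℝ)| ≤ |(q : ℝ)| + A / 2 := by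
  obtain ⟨r, s, hprs, hr, hs⟩ := exists_coeff_tdiv_tmod p q
  have hq' : 0 < |(q : ℝ)| := by positivity
  have hdeg : ∀ {u : ℤ[X]}, (∀ i, p.coeff i = 0 → u.coeff i = 0) →
      u.natDegree ≤ p.natDegree := fun hu => natDegree_le_iff_coeff_eq_zero.2 fun i hi =>
    hu i (coeff_eq_zero_of_natDegree_lt hi)
  have hrd : r.natDegree ≤ p.natDegree := hdeg fun i hi => by rw [hr, hi, Int.zero_tmod]
  have hsd : s.natDegree ≤ p.natDegree := hdeg fun i hi => by rw [hs, hi, Int.zero_tdiv]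
  refine ⟨X ^ j * r - R * s, s, ?_, ?_, fun i => ?_⟩
  · rw [hprs]; ring
  · refine (natDegree_sub_le _ _).trans (max_le ?_ ?_)
    · refine natDegree_mul_le.trans ?_
      rw [natDegree_X_pow]; omega
    · exact natDegree_mul_le.trans (by omega)
  · have hsA : ∀ i, |(s.coeff i : ℝ)| ≤ A / |(q : ℝ)| := by
      intro i
      rw [le_div_iff₀ hq', hs]
      refine le_trans ?_ (hp i)
      have h : |(p.coeff i).tdiv q| * |q| ≤ |p.coeff i| := by
        rw [← abs_mul, Int.abs_eq_natAbs, Int.abs_eq_natAbs, Int.natAbs_mul, Int.natAbs_tdiv]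
        exact_mod_cast Nat.div_mul_le_self _ _
      exact_mod_cast h
    have h1 := abs_coeff_mul_le R s hsA i
    have h2 : |((X ^ j * r).coeff i : ℝ)| ≤ |(q : ℝ)| := by
      rw [coeff_X_pow_mul']
      split_ifs
      · rw [hr]
        have : |(p.coeff (i - j)).tmod q| ≤ |q| := by
          rw [Int.abs_eq_natAbs, Int.abs_eq_natAbs, Int.natAbs_tmod]
          exact_mod_cast (Nat.mod_lt _ (Int.natAbs_pos.2 hq)).le
        exact_mod_cast this
      · simp
    have h3 : 2 * ∑ i ∈ Finset.range (R.natDegree + 1), |(R.coeff i : ℝ)| ≤ |(q : ℝ)| := by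
      exact_mod_cast hdom
    have hA : 0 ≤ A := (abs_nonneg _).trans (hp 0)
    have h4 : (∑ i ∈ Finset.range (R.natDegree + 1), |(R.coeff i : ℝ)|) * (A / |(q : ℝ)|) ≤
        A / 2 := by
      calc _ ≤ (|(q : ℝ)| / 2) * (A / |(q : ℝ)|) := by gcongr; linarith
        _ = A / 2 := by field_simp
    rw [coeff_sub, Int.cast_sub]
    exact (abs_sub _ _).trans (add_le_add h2 (h1.trans h4))

/-- Base-`q` expansion with carries along the relation `q X ^ j + R`. -/
theorem exists_bounded_digits {q : ℤ} {R : ℤ[X]} {j D : ℕ} (hq : q ≠ 0)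
    (hdom : 2 * ∑ i ∈ Finset.range (R.natDegree + 1), |R.coeff i| ≤ |q|)
    (hj : j ≤ D) (hR : R.natDegree ≤ D) (a : ℤ) (N : ℕ) :
    ∃ p s : ℤ[X], X ^ (j * N) * C a = p + (C q * X ^ j + R) * s ∧ p.natDegree ≤ D * N ∧
      ∀ i, |(p.coeff i : ℝ)| ≤ 2 * |(q : ℝ)| + |(a : ℝ)| / 2 ^ N := by
  induction N with
  | zero =>
    refine ⟨C a, 0, by simp, by simp, fun i => ?_⟩
    rw [coeff_C]
    split_ifs
    · simp
    · simp; positivity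
  | succ N ih =>
    obtain ⟨p, s, h1, h2, h3⟩ := ih
    obtain ⟨p', s', h4, h5, h6⟩ := carry_step hq hdom hj hR p h3
    -- The map `A ↦ |q| + A / 2` fixes `2 |q|` and halves the excess over it.
    refine ⟨p', s' + X ^ j * s, ?_, ?_, fun i => (h6 i).trans (le_of_eq ?_)⟩
    · rw [mul_add j, pow_add, mul_one]
      linear_combination X ^ j * h1 + h4
    · rw [mul_add]; omega
    · rw [pow_succ]; field_simp; ring

end Digits

/-! ### Logarithmic length of integer multiples. -/

namespace LaurentGroup

open Polynomial

variable {L : Type*} [Field L] {lam : Lˣ}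

theorem coe_laurentUnit_pow (m : ℕ) :
    (((laurentUnit lam : laurentRing lam) ^ m : laurentRing lam) : L) = (lam : L) ^ m := rfl

variable {S : Set (LaurentGroup lam)}

/-- Horner's scheme: nesting the conjugations by `t ^ m` makes the cost linear in the degree,
whereas conjugating each monomial separately would make it quadratic. -/
theorem wordLength_ofBase_aeval_mul_le (hS : Subgroup.closure S = ⊤) (m H D : ℕ)
    (w : laurentRing lam) (p : ℤ[X]) (hp : p.natDegree ≤ D) (hH : ∀ i, (p.coeff i).natAbs ≤ H) :
    wordLength S (ofBase lam (aeval ((laurentUnit lam : laurentRing lam) ^ m) p * w)) ≤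
      (D + 1) * (H * wordLength S (ofBase lam w) + 2 * m * wordLength S (stable lam)) := by
  induction D generalizing p with
  | zero =>
    rw [eq_C_of_natDegree_le_zero hp, aeval_C, ← Algebra.smul_def]
    refine (wordLength_ofBase_zsmul_le hS _ _).trans ?_
    have := Nat.mul_le_mul_right (wordLength S (ofBase lam w)) (hH 0)
    linarith [Nat.zero_le (2 * m * wordLength S (stable lam))]
  | succ D ih =>
    set Θ : laurentRing lam := (laurentUnit lam : laurentRing lam) ^ m with hΘ
    have e : aeval Θ p * w = p.coeff 0 • w + Θ * (aeval Θ p.divX * w) := by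
      conv_lhs => rw [← divX_mul_X_add p]
      rw [map_add, map_mul, aeval_X, aeval_C, Algebra.smul_def]
      ring
    have h1 := ih p.divX (by rw [natDegree_divX_eq_natDegree_tsub_one]; omega)
      (fun i => by rw [coeff_divX]; exact hH _)
    have h2 := wordLength_ofBase_le_of_eq hS (b := Θ * (aeval Θ p.divX * w))
      (c := aeval Θ p.divX * w) (k := m) (by
        rw [zpow_natCast, Units.val_pow_eq_pow_val, ← coe_laurentUnit_pow]; rfl)
    have h3 := wordLength_ofBase_zsmul_le hS (p.coeff 0) w
    have h4 := Nat.mul_le_mul_right (wordLength S (ofBase lam w)) (hH 0)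
    have h5 := wordLength_ofBase_add_le hS (p.coeff 0 • w) (Θ * (aeval Θ p.divX * w))
    rw [e]
    rw [Int.natAbs_natCast] at h2
    linarith

/-- Integer multiples of a fixed element of the base are exponentially distorted. -/
theorem exists_wordLength_ofBase_zsmul_le [NumberField L]
    (hconj : ∀ σ : L →+* ℂ, ‖σ (lam : L)‖ ≠ 1) (hS : Subgroup.closure S = ⊤)
    (w : laurentRing lam) :
    ∃ K : ℕ, ∀ (a : ℤ) (N : ℕ), |a| ≤ 2 ^ N →
      wordLength S (ofBase lam (a • w)) ≤ K * (N + 1) := by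
  obtain ⟨m, j, q, R, hq, hdom, hrel⟩ := exists_dominant_relation lam.ne_zero hconj
  set D := max j R.natDegree
  set H := 2 * q.natAbs + 1
  set W := wordLength S (ofBase lam w)
  set T := wordLength S (stable lam)
  refine ⟨(D + 1) * (H * W + 2 * m * T) + 2 * (m * j) * T, fun a N ha => ?_⟩
  obtain ⟨p, s, h1, h2, h3⟩ := exists_bounded_digits hq hdom (le_max_left j R.natDegree)
    (le_max_right j R.natDegree) a N
  set Θ : laurentRing lam := (laurentUnit lam : laurentRing lam) ^ m with hΘ
  have hrel' : aeval Θ (C q * X ^ j + R) = 0 := by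
    apply Subtype.ext
    have : (((laurentRing lam).val.restrictScalars ℤ) (aeval Θ (C q * X ^ j + R)) : L) = 0 := by
      rw [← aeval_algHom_apply]
      exact hrel
    exact this
  have h4 : Θ ^ (j * N) * (a : laurentRing lam) = aeval Θ p := by
    have := congrArg (aeval Θ) h1
    rw [map_add, map_mul (aeval Θ) _ s, hrel', zero_mul, add_zero] at this
    simpa using this
  have hH : ∀ i, (p.coeff i).natAbs ≤ H := by
    intro i
    have h5 : |(a : ℝ)| / 2 ^ N ≤ 1 := by
      rw [div_le_one (by positivity)]
      exact_mod_cast ha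
    have h6 : |(p.coeff i : ℝ)| ≤ 2 * |(q : ℝ)| + 1 := (h3 i).trans (by linarith)
    have h7 : |p.coeff i| ≤ 2 * |q| + 1 := by exact_mod_cast h6
    rw [Int.abs_eq_natAbs, Int.abs_eq_natAbs] at h7
    exact_mod_cast h7
  have h8 := wordLength_ofBase_aeval_mul_le hS m H (D * N) w p h2 hH
  -- Conjugation by `t ^ (-m j N)` removes the factor `Θ ^ (j N)`, at a cost linear in `N`.
  have h9 := wordLength_ofBase_le_of_eq hS (b := a • w) (c := aeval Θ p * w)
    (k := -((m * (j * N) : ℕ) : ℤ)) (by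
      rw [← h4, zpow_neg, zpow_natCast, zsmul_eq_mul]
      rw [Units.val_inv_eq_inv_val, eq_inv_mul_iff_mul_eq₀ (Units.ne_zero _)]
      rw [hΘ, ← pow_mul, mul_assoc, Units.val_pow_eq_pow_val, ← coe_laurentUnit_pow]
      rfl)
  rw [Int.natAbs_neg, Int.natAbs_natCast] at h9
  refine h9.trans ((Nat.add_le_add_right h8 _).trans ?_)
  have e1 : (D * N + 1) * (H * W + 2 * m * T) ≤ (D + 1) * (N + 1) * (H * W + 2 * m * T) := by
    gcongr
    nlinarith
  have e2 : 2 * (m * (j * N)) * T ≤ 2 * (m * (j * (N + 1))) * T := by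
    gcongr
    omega
  refine (Nat.add_le_add e1 e2).trans (le_of_eq ?_)
  ring

end LaurentGroup

/-! ### Logarithmic control of denominators. -/

section Denominators

theorem pow_card_mem_multiset_prod {R : Type*} [CommRing R] (z : R) (s : Multiset (Ideal R))
    (hs : ∀ P ∈ s, z ∈ P) : z ^ s.card ∈ s.prod := by
  induction s using Multiset.induction_on with
  | empty => simp
  | cons P s ih =>
    rw [Multiset.card_cons, Multiset.prod_cons, pow_succ']
    exact Ideal.mul_mem_mul (hs P (Multiset.mem_cons_self P s))
      (ih fun Q hQ => hs Q (Multiset.mem_cons_of_mem hQ))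

variable {L : Type*} [Field L] [NumberField L]

theorem two_pow_card_le_absNorm_prod (s : Multiset (Ideal (𝓞 L)))
    (hs : ∀ P ∈ s, P ≠ ⊥ ∧ P ≠ ⊤) : 2 ^ s.card ≤ Ideal.absNorm s.prod := by
  induction s using Multiset.induction_on with
  | empty => simp
  | cons P s ih =>
    rw [Multiset.card_cons, Multiset.prod_cons, pow_succ', map_mul]
    refine Nat.mul_le_mul ?_ (ih fun Q hQ => hs Q (Multiset.mem_cons_of_mem hQ))
    obtain ⟨h0, h1⟩ := hs P (Multiset.mem_cons_self P s)
    have h0' : Ideal.absNorm P ≠ 0 := fun h => h0 (Ideal.absNorm_eq_zero_iff.1 h)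
    have h1' : Ideal.absNorm P ≠ 1 := fun h => h1 (Ideal.absNorm_eq_one_iff.1 h)
    omega

/-- Every prime factor of `I` contains `z`, because `z ^ j ∈ I`; so `z` raised to the number of
prime factors, with multiplicity, lies in `I`. Each factor has norm at least `2`, so there are at
most `k` of them, whatever `j` is. -/
theorem pow_mem_of_absNorm_le_two_pow {I : Ideal (𝓞 L)} (hI : I ≠ ⊥) {z : 𝓞 L} {j k : ℕ}
    (hj : z ^ j ∈ I) (hk : Ideal.absNorm I ≤ 2 ^ k) : z ^ k ∈ I := by
  set s := UniqueFactorizationMonoid.normalizedFactors I with hs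
  have hprod : s.prod = I := Ideal.prod_normalizedFactors_eq_self hI
  have hprime : ∀ P ∈ s, Prime P := fun P hP =>
    UniqueFactorizationMonoid.prime_of_normalized_factor P hP
  have hz : z ^ s.card ∈ I := by
    have := pow_card_mem_multiset_prod z s fun P hP => by
      have h1 : I ≤ P := Ideal.le_of_dvd (UniqueFactorizationMonoid.dvd_of_mem_normalizedFactors hP)
      exact (Ideal.isPrime_of_prime (hprime P hP)).mem_of_pow_mem j (h1 hj)
    rwa [hprod] at this
  have hcard : 2 ^ s.card ≤ 2 ^ k := by
    have := two_pow_card_le_absNorm_prod s fun P hP =>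
      ⟨(hprime P hP).ne_zero, (Ideal.isPrime_of_prime (hprime P hP)).ne_top⟩
    rw [hprod] at this
    exact this.trans hk
  have hle : s.card ≤ k := (Nat.pow_le_pow_iff_right (by norm_num)).1 hcard
  rw [← Nat.sub_add_cancel hle, pow_add]
  exact I.mul_mem_left _ hz

/-- An element with denominator dividing a power of `z` and a natural number `E` has denominator
dividing `z ^ k` with `k` logarithmic in `E`. -/
theorem exists_integral_pow_mul {b : L} {z c e : 𝓞 L} {E j k : ℕ} (hE : E ≠ 0)
    (hc : (z : L) ^ j * b = c) (he : (E : L) * b = e)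
    (hk : E ^ Module.finrank ℚ L ≤ 2 ^ k) : ∃ r : 𝓞 L, (z : L) ^ k * b = r := by
  -- The denominator ideal of `b`. It contains `E`, so its norm divides `E ^ [L : ℚ]`.
  set I : Ideal (𝓞 L) := Submodule.comap (LinearMap.toSpanSingleton (𝓞 L) L b)
    (1 : Submodule (𝓞 L) L) with hI
  have hmem : ∀ r : 𝓞 L, r ∈ I ↔ ∃ s : 𝓞 L, (r : L) * b = s := by
    intro r
    rw [hI, Submodule.mem_comap, Submodule.mem_one, LinearMap.toSpanSingleton_apply,
      Algebra.smul_def]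
    exact exists_congr fun s => eq_comm
  have hEI : (E : 𝓞 L) ∈ I := (hmem _).2 ⟨e, by simpa using he⟩
  have hI0 : I ≠ ⊥ := fun h => by
    rw [h, Ideal.mem_bot] at hEI
    exact hE (by exact_mod_cast hEI)
  have hnorm : Ideal.absNorm I ≤ 2 ^ k := by
    refine le_trans (Nat.le_of_dvd ?_ (Ideal.absNorm_dvd_absNorm_of_le
      ((Ideal.span_singleton_le_iff_mem I).2 hEI))) ?_
    · rw [Ideal.absNorm_span_natCast]
      positivity
    · rw [Ideal.absNorm_span_natCast, NumberField.RingOfIntegers.rank]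
      exact hk
  obtain ⟨r, hr⟩ := (hmem _).1 (pow_mem_of_absNorm_le_two_pow hI0
    ((hmem (z ^ j)).2 ⟨c, by simpa using hc⟩) hnorm)
  exact ⟨r, by simpa using hr⟩

theorem exists_nat_mul_basis_integral {ι : Type*} [Fintype ι] (v : Module.Basis ι ℚ L) :
    ∃ D : ℕ, D ≠ 0 ∧ ∀ b : L, ∃ e : 𝓞 L,
      ((D * ∏ i, (v.repr b i).den : ℕ) : L) * b = e := by
  classical
  have := (IsFractionRing.comap_isAlgebraic_iff (A := ℤ) (K := ℚ) (C := L)).2 inferInstance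
  obtain ⟨y, hy, h⟩ := Algebra.IsAlgebraic.exists_integral_multiples ℤ (Finset.univ.image v)
  refine ⟨y.natAbs, Int.natAbs_ne_zero.2 hy, fun b => ?_⟩
  have hv : ∀ i, IsIntegral ℤ (((y.natAbs : ℕ) : L) * v i) := by
    intro i
    have h1 : IsIntegral ℤ ((y : L) * v i) := by
      rw [← zsmul_eq_mul]
      exact h _ (Finset.mem_image_of_mem v (Finset.mem_univ i))
    rcases y.natAbs_eq with hy' | hy'
    · rw [hy'] at h1
      simpa using h1
    · rw [hy'] at h1
      simpa using h1.neg
  have hint : IsIntegral ℤ (((y.natAbs * ∏ i, (v.repr b i).den : ℕ) : L) * b) := by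
    suffices h : IsIntegral ℤ (((y.natAbs * ∏ i, (v.repr b i).den : ℕ) : L) *
        ∑ i, v.repr b i • v i) by rwa [v.sum_repr b] at h
    rw [Finset.mul_sum]
    refine IsIntegral.sum _ fun i _ => ?_
    obtain ⟨r, hr⟩ := Finset.dvd_prod_of_mem (fun i => (v.repr b i).den) (Finset.mem_univ i)
    have hq : (((v.repr b i).den : ℕ) : L) * ((v.repr b i : ℚ) : L) = ((v.repr b i).num : L) := by
      have := Rat.den_mul_eq_num (v.repr b i)
      exact_mod_cast congrArg (fun q : ℚ => (q : L)) this
    have e : ((y.natAbs * ∏ i, (v.repr b i).den : ℕ) : L) * (v.repr b i • v i) =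
        ((r * (v.repr b i).num : ℤ) : L) * (((y.natAbs : ℕ) : L) * v i) := by
      rw [hr, Algebra.smul_def, eq_ratCast]
      push_cast
      rw [← hq]
      ring
    rw [e]
    exact (isIntegral_algebraMap (R := ℤ) (A := L) (x := (r * (v.repr b i).num : ℤ))).mul (hv i)
  exact ⟨⟨_, hint⟩, rfl⟩

end Denominators

/-! ### Growth of coordinates under linear maps. -/

section Coordinates

theorem exists_repr_apply_le {ι κ V W : Type*} [Fintype ι] [Fintype κ] [AddCommGroup V]
    [AddCommGroup W] [Module ℚ V] [Module ℚ W] (v : Module.Basis ι ℚ V) (w : Module.Basis κ ℚ W)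
    (T : V →ₗ[ℚ] W) : ∃ c : ℕ, ∀ (A : ℚ) (a : V), 0 ≤ A → (∀ i, |v.repr a i| ≤ A) →
      ∀ k, |w.repr (T a) k| ≤ 2 ^ c * A := by
  obtain ⟨c, hc⟩ := pow_unbounded_of_one_lt (∑ k, ∑ i, |w.repr (T (v i)) k|) one_lt_two (R := ℚ)
  refine ⟨c, fun A a hA ha k => ?_⟩
  have e : w.repr (T a) k = ∑ i, v.repr a i * w.repr (T (v i)) k := by
    conv_lhs => rw [← v.sum_repr a]
    rw [map_sum, map_sum, Finsupp.finsetSum_apply]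
    simp
  rw [e]
  calc |∑ i, v.repr a i * w.repr (T (v i)) k| ≤ ∑ i, |v.repr a i * w.repr (T (v i)) k| :=
        Finset.abs_sum_le_sum_abs _ _
    _ ≤ ∑ i, A * |w.repr (T (v i)) k| := by
        refine Finset.sum_le_sum fun i _ => ?_
        rw [abs_mul]
        exact mul_le_mul_of_nonneg_right (ha i) (abs_nonneg _)
    _ = A * ∑ i, |w.repr (T (v i)) k| := by rw [Finset.mul_sum]
    _ ≤ A * 2 ^ c := by
        refine mul_le_mul_of_nonneg_left (le_trans ?_ hc.le) hA
        exact Finset.single_le_sum (f := fun k => ∑ i, |w.repr (T (v i)) k|)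
          (fun k _ => Finset.sum_nonneg fun i _ => abs_nonneg _) (Finset.mem_univ k)
    _ = 2 ^ c * A := mul_comm _ _

theorem exists_repr_pow_mul_le {κ L : Type*} [Fintype κ] [Field L] [CharZero L]
    (e : Module.Basis κ ℚ L) (z : L) : ∃ c : ℕ, ∀ (n : ℕ) (A : ℚ) (a : L),
      0 ≤ A → (∀ i, |e.repr a i| ≤ A) → ∀ i, |e.repr (z ^ n * a) i| ≤ 2 ^ (c * n) * A := by
  obtain ⟨c, hc⟩ := exists_repr_apply_le e e (LinearMap.mulLeft ℚ z)
  refine ⟨c, fun n A a hA ha => ?_⟩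
  induction n with
  | zero => simpa using ha
  | succ n ih =>
    intro i
    have := hc _ _ (by positivity) ih i
    rw [LinearMap.mulLeft_apply, ← mul_assoc, ← pow_succ'] at this
    refine this.trans (le_of_eq ?_)
    ring

end Coordinates

/-! ### Splitting `b` into `λ ^ k u + λ ^ (-k) w`. -/

section Splitting

open NumberField

variable {L : Type*} [Field L]

theorem exists_integer_repr_sub_le_one [NumberField L] (z : L) :
    ∃ f : 𝓞 L, ∀ i, |(integralBasis L).repr (z - f) i| ≤ 1 := by
  refine ⟨∑ i, ⌊(integralBasis L).repr z i⌋ • RingOfIntegers.basis L i, fun i => ?_⟩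
  rw [map_sub, Finsupp.sub_apply, integralBasis_repr_apply, Module.Basis.repr_sum_self]
  rw [eq_intCast, Int.self_sub_floor, abs_of_nonneg (Int.fract_nonneg _)]
  exact (Int.fract_lt_one _).le

/-- From `p x ^ (2k) + q y ^ (2k) = 1` and `r = (x y) ^ k b` one gets `b = λ ^ k (r p) + λ ^ (-k) (r
q)`, without control of `p` and `q`. As `λ ^ k y ^ (2k) = λ ^ (-k) x ^ (2k)`, a multiple `f` of this
element can be moved between the summands. Rounding `r p / y ^ (2k)` to `f` makes `u` small, and `w
= λ ^ k b - λ ^ (2k) u` is then small as well. -/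
theorem exists_split_of_pow_mul_integral [NumberField L] {x y : 𝓞 L} (hx : x ≠ 0) (hy : y ≠ 0)
    (hxy : IsCoprime x y) :
    ∃ c : ℕ, ∀ (k : ℕ) (A : ℚ) (b : L), 1 ≤ A → (∀ i, |(integralBasis L).repr b i| ≤ A) →
      (∃ r : 𝓞 L, ((x * y : 𝓞 L) : L) ^ k * b = r) →
      ∃ u w : 𝓞 L, b = ((x : L) / y) ^ k * u + (((x : L) / y) ^ k)⁻¹ * w ∧
        (∀ i, |(integralBasis L).repr (u : L) i| ≤ 2 ^ (c * (k + 1)) * A) ∧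
        (∀ i, |(integralBasis L).repr (w : L) i| ≤ 2 ^ (c * (k + 1)) * A) := by
  obtain ⟨c₁, hc₁⟩ := exists_repr_pow_mul_le (integralBasis L) (y : L)
  obtain ⟨c₂, hc₂⟩ := exists_repr_pow_mul_le (integralBasis L) ((x : L) / y)
  refine ⟨2 * c₁ + 2 * c₂ + 1, fun k A b hA hb ⟨r, hr⟩ => ?_⟩
  have hxL : (x : L) ≠ 0 := by simpa using hx
  have hyL : (y : L) ≠ 0 := by simpa using hy
  obtain ⟨p, q, hpq⟩ := hxy.pow (m := 2 * k) (n := 2 * k)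
  obtain ⟨f, hf⟩ := exists_integer_repr_sub_le_one ((r * p : 𝓞 L) / (y : L) ^ (2 * k) : L)
  have hpq' : (p : L) * (x : L) ^ (2 * k) + q * (y : L) ^ (2 * k) = 1 := by
    exact_mod_cast congrArg (algebraMap (𝓞 L) L) hpq
  have hA0 : 0 ≤ A := by linarith
  set u : 𝓞 L := r * p - f * y ^ (2 * k) with hu
  set w : 𝓞 L := r * q + f * x ^ (2 * k) with hw
  have huL : (u : L) = r * p - f * (y : L) ^ (2 * k) := by rw [hu]; push_cast; ring
  have hwL : (w : L) = r * q + f * (x : L) ^ (2 * k) := by rw [hw]; push_cast; ring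
  have hr' : (x : L) ^ k * (y : L) ^ k * b = r := by rw [← hr]; push_cast; ring
  have hb' : b = ((x : L) / y) ^ k * u + (((x : L) / y) ^ k)⁻¹ * w := by
    rw [huL, hwL, div_pow]
    field_simp
    linear_combination hr' - r * hpq'
  have hu1 : ∀ i, |(integralBasis L).repr (u : L) i| ≤ 2 ^ (c₁ * (2 * k)) * 1 := by
    have e : (u : L) = (y : L) ^ (2 * k) * (((r * p : 𝓞 L) : L) / (y : L) ^ (2 * k) - f) := by
      rw [huL]
      field_simp
      push_cast
      ring
    rw [e]
    exact hc₁ _ _ _ zero_le_one hf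
  have hw1 : ∀ i, |(integralBasis L).repr (w : L) i| ≤
      2 ^ (c₂ * k) * A + 2 ^ (c₂ * (2 * k)) * (2 ^ (c₁ * (2 * k)) * 1) := by
    have e : (w : L) = ((x : L) / y) ^ k * b - ((x : L) / y) ^ (2 * k) * u := by
      have h0 : ((x : L) / y) ^ k ≠ 0 := by positivity
      conv_rhs => rw [hb']
      field_simp
      ring
    intro i
    rw [e, map_sub, Finsupp.sub_apply]
    exact (abs_sub _ _).trans (add_le_add (hc₂ _ _ _ hA0 hb i)
      (hc₂ _ _ _ (by positivity) hu1 i))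
  refine ⟨u, w, hb', fun i => (hu1 i).trans ?_, fun i => (hw1 i).trans ?_⟩
  · refine mul_le_mul (pow_le_pow_right₀ one_le_two ?_) hA zero_le_one (by positivity)
    nlinarith
  · have h1 : (2 : ℚ) ^ (c₂ * k) * A ≤ 2 ^ ((2 * c₁ + 2 * c₂) * k) * A := by
      refine mul_le_mul_of_nonneg_right (pow_le_pow_right₀ one_le_two ?_) hA0
      nlinarith [Nat.zero_le (c₁ * k), Nat.zero_le (c₂ * k)]
    have h2 : (2 : ℚ) ^ (c₂ * (2 * k)) * (2 ^ (c₁ * (2 * k)) * 1) ≤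
        2 ^ ((2 * c₁ + 2 * c₂) * k) * A := by
      rw [mul_one, ← pow_add]
      refine (le_of_eq ?_).trans (le_mul_of_one_le_right (by positivity) hA)
      congr 1
      ring
    calc _ ≤ 2 ^ ((2 * c₁ + 2 * c₂) * k + 1) * A := by rw [pow_succ]; linarith
      _ ≤ _ := by
        refine mul_le_mul_of_nonneg_right (pow_le_pow_right₀ one_le_two ?_) hA0
        nlinarith

/-- The exponent `j` is uncontrolled here; its mere existence feeds the prime-ideal count. -/
theorem exists_pow_mul_integral_of_mem_laurentRing {x y : 𝓞 L} (hx : x ≠ 0) (hy : y ≠ 0)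
    {lam : Lˣ} (hlam : (lam : L) = (x : L) / y) {b : L} (hb : b ∈ laurentRing lam) :
    ∃ (j : ℕ) (r : 𝓞 L), ((x * y : 𝓞 L) : L) ^ j * b = r := by
  have hxL : (x : L) ≠ 0 := by simpa using hx
  have hyL : (y : L) ≠ 0 := by simpa using hy
  induction hb using Algebra.adjoin_induction with
  | mem z hz =>
    rcases hz with rfl | rfl
    · refine ⟨1, x ^ 2, ?_⟩
      rw [hlam]
      push_cast
      field_simp
    · refine ⟨1, y ^ 2, ?_⟩
      rw [Units.val_inv_eq_inv_val, hlam]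
      push_cast
      field_simp
  | algebraMap r => exact ⟨0, r, by simp⟩
  | add a b _ _ ha hb =>
    obtain ⟨j, r, hr⟩ := ha
    obtain ⟨k, s, hs⟩ := hb
    refine ⟨j + k, (x * y) ^ k * r + (x * y) ^ j * s, ?_⟩
    have e : ((x * y : 𝓞 L) : L) ^ (j + k) * (a + b) = ((x * y : 𝓞 L) : L) ^ k *
      (((x * y : 𝓞 L) : L) ^ j * a) + ((x * y : 𝓞 L) : L) ^ j *
        (((x * y : 𝓞 L) : L) ^ k * b) := by ring
    rw [e, hr, hs]
    simp
  | mul a b _ _ ha hb =>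
    obtain ⟨j, r, hr⟩ := ha
    obtain ⟨k, s, hs⟩ := hb
    refine ⟨j + k, r * s, ?_⟩
    rw [pow_add, mul_mul_mul_comm, hr, hs]
    simp

theorem Rat.den_le_ratMu_add_one (q : ℚ) : q.den ≤ ratMu q + 1 := by
  rw [ratMu]
  rcases eq_or_ne q 0 with rfl | hq
  · simp
  · have := Nat.le_mul_of_pos_left q.den (Int.natAbs_pos.2 (Rat.num_ne_zero.2 hq))
    omega

theorem Rat.abs_le_ratMu (q : ℚ) : |q| ≤ ratMu q := by
  have h1 : |q| = |(q.num : ℚ)| / q.den := by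
    conv_lhs => rw [← Rat.num_div_den q]
    rw [abs_div, Nat.abs_cast]
  have h2 : (1 : ℚ) ≤ q.den := by exact_mod_cast q.den_pos
  rw [h1, ratMu, Nat.cast_mul, Nat.cast_natAbs, Int.cast_abs, div_le_iff₀ (by linarith), mul_assoc]
  exact le_mul_of_one_le_right (abs_nonneg _) (by nlinarith)

theorem exists_logarithmic_split [NumberField L] {x y : 𝓞 L} (hx : x ≠ 0)
    (hy : y ≠ 0) (hxy : IsCoprime x y)
    {lam : Lˣ} (hlam : (lam : L) = (x : L) / y) {ι : Type*} [Fintype ι]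
    (v : Module.Basis ι ℚ L) :
    ∃ c : ℕ, ∀ b ∈ laurentRing lam, ∀ N : ℕ, muE v b + 1 ≤ 2 ^ N →
      ∃ (k : ℕ) (u w : 𝓞 L), k ≤ c * (N + 1) ∧
        b = (lam : L) ^ k * u + ((lam : L) ^ k)⁻¹ * w ∧
        (∀ i, |(RingOfIntegers.basis L).repr u i| ≤ 2 ^ (c * (N + 1))) ∧
        (∀ i, |(RingOfIntegers.basis L).repr w i| ≤ 2 ^ (c * (N + 1))) := by
  obtain ⟨D, hD, hDint⟩ := exists_nat_mul_basis_integral v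
  obtain ⟨c₁, hc₁⟩ := exists_split_of_pow_mul_integral hx hy hxy
  obtain ⟨c₂, hc₂⟩ := exists_repr_apply_le v (integralBasis L) LinearMap.id
  set d := Module.finrank ℚ L
  set n := Fintype.card ι
  set c₃ := (D + n) * d with hc₃
  refine ⟨c₃ + (c₁ * (c₃ + 1) + c₂ + 1), fun b hb N hN => ?_⟩
  have hmu : ∀ i, ratMu (v.repr b i) ≤ muE v b := fun i =>
    Finset.single_le_sum (f := fun i => ratMu (v.repr b i)) (fun _ _ => Nat.zero_le _)
      (Finset.mem_univ i)
  obtain ⟨j, r, hr⟩ := exists_pow_mul_integral_of_mem_laurentRing hx hy hlam hb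
  obtain ⟨e, he⟩ := hDint b
  set E := D * ∏ i, (v.repr b i).den with hE
  have hE0 : E ≠ 0 := mul_ne_zero hD (Finset.prod_ne_zero_iff.2 fun i _ => (v.repr b i).den_nz)
  -- Each coordinate has denominator at most `2 ^ N`, and `D ≤ 2 ^ D`.
  have hEk : E ^ d ≤ 2 ^ (c₃ * (N + 1)) := by
    have h1 : E ≤ 2 ^ D * (2 ^ N) ^ n := by
      refine Nat.mul_le_mul Nat.lt_two_pow_self.le ?_
      refine Finset.prod_le_pow_card _ _ _ fun i _ => ?_
      have := hmu i
      exact (Rat.den_le_ratMu_add_one _).trans (by omega)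
    calc E ^ d ≤ (2 ^ D * (2 ^ N) ^ n) ^ d := by gcongr
      _ = 2 ^ ((D + N * n) * d) := by rw [← pow_mul, ← pow_add, ← pow_mul]
      _ ≤ 2 ^ (c₃ * (N + 1)) := by
        refine Nat.pow_le_pow_right (by norm_num) ?_
        have : D + N * n ≤ (D + n) * (N + 1) := by nlinarith [Nat.zero_le (D * N)]
        calc (D + N * n) * d ≤ (D + n) * (N + 1) * d := by gcongr
          _ = _ := by rw [hc₃]; ring
  set k := c₃ * (N + 1) with hk
  obtain ⟨s, hs⟩ := exists_integral_pow_mul hE0 hr he hEk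
  have hbA : ∀ i, |(integralBasis L).repr b i| ≤ 2 ^ c₂ * 2 ^ N := by
    refine hc₂ (2 ^ N) b (by positivity) fun i => (Rat.abs_le_ratMu _).trans ?_
    have : ratMu (v.repr b i) ≤ 2 ^ N := by have := hmu i; omega
    exact_mod_cast this
  have hA1 : (1 : ℚ) ≤ 2 ^ c₂ * 2 ^ N := by
    rw [← pow_add]
    exact one_le_pow₀ one_le_two
  obtain ⟨u, w, h1, h2, h3⟩ := hc₁ k _ b hA1 hbA ⟨s, hs⟩
  have hpow : (2 : ℚ) ^ (c₁ * (k + 1)) * (2 ^ c₂ * 2 ^ N) ≤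
      2 ^ ((c₃ + (c₁ * (c₃ + 1) + c₂ + 1)) * (N + 1)) := by
    rw [← pow_add, ← pow_add]
    refine pow_le_pow_right₀ one_le_two ?_
    rw [hk]
    nlinarith [Nat.zero_le (c₁ * N), Nat.zero_le (c₂ * N), Nat.zero_le (c₃ * (N + 1))]
  refine ⟨k, u, w, ?_, by rw [hlam]; exact h1, fun i => ?_, fun i => ?_⟩
  · exact Nat.mul_le_mul_right _ (Nat.le_add_right _ _)
  · have := (h2 i).trans hpow
    rw [integralBasis_repr_apply, eq_intCast] at this
    exact_mod_cast this
  · have := (h3 i).trans hpow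
    rw [integralBasis_repr_apply, eq_intCast] at this
    exact_mod_cast this

end Splitting

/-! ### Word length on `B` and finite generation of `G`. -/

namespace LaurentGroup

open NumberField

variable {L : Type*} [Field L] {lam : Lˣ} {S : Set (LaurentGroup lam)}

theorem exists_wordLength_ofBase_algebraMap_le
    [NumberField L] (hconj : ∀ σ : L →+* ℂ, ‖σ (lam : L)‖ ≠ 1) (hS : Subgroup.closure S = ⊤) :
    ∃ K : ℕ, ∀ (u : 𝓞 L) (N : ℕ), (∀ i, |(RingOfIntegers.basis L).repr u i| ≤ 2 ^ N) →
      wordLength S (ofBase lam (algebraMap (𝓞 L) (laurentRing lam) u)) ≤ K * (N + 1) := by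
  choose K hK using fun i => exists_wordLength_ofBase_zsmul_le hconj hS
    (algebraMap (𝓞 L) (laurentRing lam) (RingOfIntegers.basis L i))
  refine ⟨∑ i, K i, fun u N hu => ?_⟩
  conv_lhs => rw [← (RingOfIntegers.basis L).sum_repr u]
  rw [map_sum, Finset.sum_mul]
  refine (wordLength_ofBase_sum_le hS _ _).trans (Finset.sum_le_sum fun i _ => ?_)
  rw [map_zsmul]
  exact hK i _ _ (hu i)

theorem exists_eq_add_conj {b : laurentRing lam} {k : ℕ} {u w : 𝓞 L}
    (h : (b : L) = (lam : L) ^ k * u + ((lam : L) ^ k)⁻¹ * w) :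
    ∃ b₁ b₂ : laurentRing lam, b = b₁ + b₂ ∧
      (b₁ : L) = ((lam ^ (k : ℤ) : Lˣ) : L) * algebraMap (𝓞 L) (laurentRing lam) u ∧
      (b₂ : L) = ((lam ^ (-(k : ℤ)) : Lˣ) : L) * algebraMap (𝓞 L) (laurentRing lam) w := by
  refine ⟨(laurentUnit lam : laurentRing lam) ^ k * algebraMap (𝓞 L) (laurentRing lam) u,
    ((laurentUnit lam)⁻¹ : (laurentRing lam)ˣ) ^ k * algebraMap (𝓞 L) (laurentRing lam) w,
    ?_, ?_, ?_⟩
  · apply Subtype.ext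
    rw [h, ← inv_pow, ← Units.val_inv_eq_inv_val]
    rfl
  · rw [zpow_natCast, Units.val_pow_eq_pow_val]
    rfl
  · rw [zpow_neg, zpow_natCast, ← inv_pow, Units.val_pow_eq_pow_val]
    rfl

theorem exists_wordLength_ofBase_le [NumberField L] {x y : 𝓞 L} (hx : x ≠ 0) (hy : y ≠ 0) (hxy : IsCoprime x y)
    (hlam : (lam : L) = (x : L) / y) (hconj : ∀ σ : L →+* ℂ, ‖σ (lam : L)‖ ≠ 1)
    (hS : Subgroup.closure S = ⊤) {ι : Type*} [Fintype ι] (v : Module.Basis ι ℚ L) :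
    ∃ K : ℕ, ∀ (b : laurentRing lam) (N : ℕ), muE v (b : L) + 1 ≤ 2 ^ N →
      wordLength S (ofBase lam b) ≤ K * (N + 1) := by
  obtain ⟨c, hc⟩ := exists_logarithmic_split hx hy hxy hlam v
  obtain ⟨K, hK⟩ := exists_wordLength_ofBase_algebraMap_le hconj hS
  set T := wordLength S (stable lam)
  refine ⟨2 * (K * (c + 1)) + 4 * c * T, fun b N hN => ?_⟩
  obtain ⟨k, u, w, hk, hb, hu, hw⟩ := hc b b.2 N hN
  obtain ⟨b₁, b₂, hb12, h1, h2⟩ := exists_eq_add_conj hb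
  have e1 := wordLength_ofBase_le_of_eq hS h1
  have e2 := wordLength_ofBase_le_of_eq hS h2
  have e3 := hK u _ hu
  have e4 := hK w _ hw
  have e5 := wordLength_ofBase_add_le hS b₁ b₂
  rw [Int.natAbs_natCast] at e1
  rw [Int.natAbs_neg, Int.natAbs_natCast] at e2
  have e6 : 2 * k * T ≤ 2 * (c * (N + 1)) * T := by gcongr
  have e7 : K * (c * (N + 1) + 1) ≤ K * (c + 1) * (N + 1) := by
    rw [mul_assoc]
    gcongr
    linarith
  rw [hb12]
  linarith

theorem group_fg [NumberField L] {x y : 𝓞 L} (hx : x ≠ 0) (hy : y ≠ 0) (hxy : IsCoprime x y)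
    (hlam : (lam : L) = (x : L) / y) : Group.FG (LaurentGroup lam) := by
  obtain ⟨c, hc⟩ := exists_logarithmic_split hx hy hxy hlam (integralBasis L)
  set F : Set (LaurentGroup lam) := insert (stable lam)
    (Set.range fun i => ofBase lam (algebraMap (𝓞 L) (laurentRing lam) (RingOfIntegers.basis L i)))
    with hF
  refine Group.fg_iff.2 ⟨F, ?_, (Set.finite_range _).insert _⟩
  have ht : stable lam ∈ Subgroup.closure F := Subgroup.subset_closure (Set.mem_insert _ _)
  have hsum : ∀ {κ : Type _} (s : Finset κ) (f : κ → laurentRing lam),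
      (∀ i, ofBase lam (f i) ∈ Subgroup.closure F) →
      ofBase lam (∑ i ∈ s, f i) ∈ Subgroup.closure F := by
    classical
    intro κ s f hf
    induction s using Finset.induction_on with
    | empty => simp [ofBase]
    | insert a s ha ih =>
      rw [Finset.sum_insert ha, ofBase_add]
      exact mul_mem (hf a) ih
  have hO : ∀ u : 𝓞 L, ofBase lam (algebraMap (𝓞 L) (laurentRing lam) u) ∈
      Subgroup.closure F := by
    intro u
    rw [← (RingOfIntegers.basis L).sum_repr u, map_sum]
    refine hsum _ _ fun i => ?_
    rw [map_zsmul, ofBase_zsmul]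
    exact zpow_mem (Subgroup.subset_closure (Set.mem_insert_of_mem _ (Set.mem_range_self i))) _
  have hB : ∀ b : laurentRing lam, ofBase lam b ∈ Subgroup.closure F := by
    intro b
    -- Only the shape of the splitting matters here, so any `N` with `muE + 1 ≤ 2 ^ N` will do.
    obtain ⟨k, u, w, -, hb, -, -⟩ := hc b b.2 (muE (integralBasis L) (b : L) + 1)
      Nat.lt_two_pow_self.le
    obtain ⟨b₁, b₂, rfl, h1, h2⟩ := exists_eq_add_conj hb
    rw [ofBase_add, ofBase_eq_conj h1, ofBase_eq_conj h2]
    exact mul_mem (mul_mem (mul_mem (zpow_mem ht _) (hO _)) (inv_mem (zpow_mem ht _)))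
      (mul_mem (mul_mem (zpow_mem ht _) (hO _)) (inv_mem (zpow_mem ht _)))
  refine (Subgroup.eq_top_iff' _).2 fun g => ?_
  obtain ⟨b, k, rfl⟩ := eq_ofBase_mul_zpow g
  exact mul_mem (hB b) (zpow_mem ht k)

end LaurentGroup

/-! ### From powers of two to the natural logarithm. -/

theorem exists_two_pow_ge_le_log (m : ℕ) :
    ∃ N : ℕ, m + 1 ≤ 2 ^ N ∧ (N : ℝ) ≤ 2 * Real.log ((m : ℝ) + 1) + 1 := by
  refine ⟨Nat.log 2 (m + 1) + 1, (Nat.lt_pow_succ_log_self one_lt_two _).le, ?_⟩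
  have h1 : ((2 : ℝ) ^ Nat.log 2 (m + 1)) ≤ (m : ℝ) + 1 := by
    exact_mod_cast Nat.pow_log_le_self 2 (Nat.succ_ne_zero m)
  have h2 := Real.log_le_log (by positivity) h1
  rw [Real.log_pow] at h2
  have h3 : (1 : ℝ) / 2 ≤ Real.log 2 := by linarith [Real.log_two_gt_d9]
  have h4 : (0 : ℝ) ≤ Nat.log 2 (m + 1) := Nat.cast_nonneg _
  push_cast
  nlinarith

theorem mainTheorem4 {L : Type*} [Field L] [NumberField L]
    (x y : 𝓞 L) (hx : x ≠ 0) (hy : y ≠ 0)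
    (hxy : Ideal.span {x} ⊔ Ideal.span {y} = ⊤)
    (lam : Lˣ) (hlam : (lam : L) = (x : L) / (y : L))
    (hconj : ∀ σ : L →+* ℂ, ‖σ (lam : L)‖ ≠ 1) :
    Group.FG (LaurentGroup lam) ∧
      ∀ S : Set (LaurentGroup lam), S.Finite → Subgroup.closure S = ⊤ →
        ∀ (ι : Type*) [Fintype ι] (v : Module.Basis ι ℚ L),
          QuasiLE
            (fun b : laurentRing lam => (wordLength S (LaurentGroup.ofBase lam b) : ℝ))
            (fun b : laurentRing lam => Real.log ((muE v (b : L) : ℝ) + 1)) := by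
  have hcop : IsCoprime x y :=
    (Ideal.isCoprime_span_singleton_iff x y).1 (Ideal.isCoprime_iff_sup_eq.2 hxy)
  refine ⟨LaurentGroup.group_fg hx hy hcop hlam, fun S _ hS ι _ v => ?_⟩
  obtain ⟨K, hK⟩ := LaurentGroup.exists_wordLength_ofBase_le hx hy hcop hlam hconj hS v
  -- `K (N + 1) ≤ 2 K log (μ_E(b) + 1) + 2 K`; the extra `1` in the slope ensures `M ≥ 1`.
  refine ⟨2 * K, by positivity, 2 * K + 1, by linarith [(Nat.cast_nonneg K : (0 : ℝ) ≤ K)],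
    fun b => ?_⟩
  obtain ⟨N, hN, hNlog⟩ := exists_two_pow_ge_le_log (muE v (b : L))
  have h1 : (wordLength S (LaurentGroup.ofBase lam b) : ℝ) ≤ K * (N + 1) := by
    exact_mod_cast hK b N hN
  have h2 : 0 ≤ Real.log ((muE v (b : L) : ℝ) + 1) := Real.log_nonneg (by simp)
  have h3 := mul_le_mul_of_nonneg_left hNlog (Nat.cast_nonneg K : (0 : ℝ) ≤ K)
  simp only
  linarith
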